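/- Let $\varepsilon>0$ and let $d\ge 1$ be an integer. Consider a randomized algorithm which, for every $n>d$, takes as input a fully known matrix $A\in\mathbb{R}^{n\times d}$ and a vector $b\in\mathbb{R}^n$ that it can access only by reading its entries. The entries are read one at a time, and the choice of the next entry, the decision to stop and the output $\hat{x}\in\mathbb{R}^d$ may depend arbitrarily on $A$, on a random seed whose law does not depend on the problem, and on the entries of $b$ read so far. Suppose that for every $n>d$, every $A\in\mathbb{R}^{n\times d}$ and every $b\in\mathbb{R}^n$ the output has a well-defined finite mean square residual error with $$\mathbb{E}\,\lVert b-A\hat{x}\rVert^2\le(1+\varepsilon)\,\lVert b-Ax_\star\rVert^2,$$ where $x_\star$ is any solution of the least-squares problem $\min_{x\in\mathbb{R}^d}\lVert b-Ax\rVert^2$, $\lVert\cdot\rVert$ is the Euclidean norm, and the expectation is over the random seed. Suppose also that, for some integer $t\ge 0$, on each of these problems the algorithm almost surely accesses at most $t$ distinct entries of $b$. Then $$t\ge \frac{d}{\varepsilon}.$$ -/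

import Mathlib

open MeasureTheory

/-- A (deterministic, adaptive) program that has access to a vector `b ∈ ℝⁿ` only by reading its
entries one at a time, and that returns a vector in `ℝᵈ`.  It either stops with an output, or reads
an entry `b i` and continues in a way that may depend arbitrarily on the value that was read
(hence on all the values read so far). -/
inductive EntryAccessProgram (n d : ℕ) : Type
  | output (x : EuclideanSpace ℝ (Fin d)) : EntryAccessProgram n d
  | access (i : Fin n) (next : ℝ → EntryAccessProgram n d) : EntryAccessProgram n d

namespace EntryAccessProgram

/-- The vector returned when the program is run on `b`. -/
def result {n d : ℕ} : EntryAccessProgram n d → EuclideanSpace ℝ (Fin n) → EuclideanSpace ℝ (Fin d)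
  | output x, _ => x
  | access i next, b => (next (b i)).result b

/-- The set of (indices of) entries of `b` that are accessed when the program is run on `b`.
An entry that is read repeatedly is counted only once. -/
def accessed {n d : ℕ} : EntryAccessProgram n d → EuclideanSpace ℝ (Fin n) → Finset (Fin n)
  | output _, _ => ∅
  | access i next, b => insert i ((next (b i)).accessed b)

end EntryAccessProgram

/-- The residual vector `b - A x`, in Euclidean space. -/
noncomputable def lsResidual {n d : ℕ} (A : Matrix (Fin n) (Fin d) ℝ)
    (b : EuclideanSpace ℝ (Fin n)) (x : EuclideanSpace ℝ (Fin d)) : EuclideanSpace ℝ (Fin n) :=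
  b - Matrix.toEuclideanLin A x

/-- `x` is a solution of the least-squares problem `min_x ‖b - A x‖²`. -/
def IsLeastSquaresSolution {n d : ℕ} (A : Matrix (Fin n) (Fin d) ℝ)
    (b : EuclideanSpace ℝ (Fin n)) (x : EuclideanSpace ℝ (Fin d)) : Prop :=
  ∀ y : EuclideanSpace ℝ (Fin d), ‖lsResidual A b x‖ ^ 2 ≤ ‖lsResidual A b y‖ ^ 2

/-- Every least-squares problem has a solution. -/
theorem exists_isLeastSquaresSolution {n d : ℕ} (A : Matrix (Fin n) (Fin d) ℝ)
    (b : EuclideanSpace ℝ (Fin n)) : ∃ x, IsLeastSquaresSolution A b x := by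
  obtain ⟨x, hx⟩ := (LinearMap.range (Matrix.toEuclideanLin A)).starProjection_apply_mem b
  refine ⟨x, fun y => ?_⟩
  unfold lsResidual
  rw [hx, Submodule.starProjection_minimal]
  gcongr
  · exact Real.iInf_nonneg fun _ => norm_nonneg _
  · exact ciInf_le
      (f := fun z : LinearMap.range (Matrix.toEuclideanLin A) => ‖b - (z : EuclideanSpace ℝ (Fin n))‖)
      ⟨0, Set.forall_mem_range.2 fun z => norm_nonneg _⟩ ⟨_, LinearMap.mem_range_self _ y⟩

/-- A randomized algorithm for least-squares problems with `d` unknowns.  For every number `n` of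
equations, every matrix `A` (which is fully known to the algorithm) and every random seed `ω`, it
runs a program that accesses the entries of `b` one at a time. -/
abbrev LeastSquaresAlgorithm (d : ℕ) (Ω : Type*) : Type _ :=
  (n : ℕ) → Matrix (Fin n) (Fin d) ℝ → Ω → EntryAccessProgram n d

/-- On every overdetermined least-squares problem with `d` unknowns, the algorithm almost surely
accesses at most `t` entries of `b`. -/
def AccessesAtMost {d : ℕ} {Ω : Type*} [MeasurableSpace Ω] (P : Measure Ω)
    (alg : LeastSquaresAlgorithm d Ω) (t : ℕ) : Prop :=
  ∀ (n : ℕ) (A : Matrix (Fin n) (Fin d) ℝ) (b : EuclideanSpace ℝ (Fin n)), d < n →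
    ∀ᵐ ω ∂P, ((alg n A ω).accessed b).card ≤ t

/-- On every overdetermined least-squares problem with `d` unknowns, the output `x̂` of the algorithm
has a well-defined finite mean square residual error `E ‖b - A x̂‖²`, which is at most
`(1 + ε) ‖b - A x⋆‖²`, where `x⋆` is a least-squares solution. -/
def HasMeanSquareResidualError {d : ℕ} {Ω : Type*} [MeasurableSpace Ω] (P : Measure Ω)
    (alg : LeastSquaresAlgorithm d Ω) (ε : ℝ) : Prop :=
  ∀ (n : ℕ) (A : Matrix (Fin n) (Fin d) ℝ) (b : EuclideanSpace ℝ (Fin n))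
    (xstar : EuclideanSpace ℝ (Fin d)), d < n → IsLeastSquaresSolution A b xstar →
    Integrable (fun ω => ‖lsResidual A b ((alg n A ω).result b)‖ ^ 2) P ∧
      ∫ ω, ‖lsResidual A b ((alg n A ω).result b)‖ ^ 2 ∂P ≤ (1 + ε) * ‖lsResidual A b xstar‖ ^ 2

/-!
The bound is a Bayes risk computation for a prior under which the posterior variance depends
essentially only on how many entries have been read.

Split `n = d * m` rows into `d` blocks of `m` rows, and let `A` be the block indicator matrix, so
that `‖b - A x‖² = ∑ i, (b i - x (blk i))²`. Draw independent `θ j ~ Beta(a + 1, a + 1)` and then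
independent `b i ~ Bin(N, θ (blk i))`. The optimum is at most the residual at `x j = N θ j`, whose
mean is `m N ∑ j, E[v j]` with `v j = θ j (1 - θ j)`. Conversely, by conjugacy, once `k` entries of
block `j` are known, predicting an unread entry of that block costs on average at least
`(N + N² / K) v j`, where `K = 2 (a + 1) + N k` (`integral_beta_quadratic`,
`unread_entry_risk_nonneg`). An induction on the program (`EntryAccessProgram.sum_run_nonneg`)
transfers this from fixed sets of known entries to adaptively chosen ones.

An adaptive algorithm can correlate the numbers `k` with the `v j`. The bound
`N² v / K ≥ 2 ε N v - ε² K / 4`, valid because `v ≤ 1 / 4`, removes this correlation: it is linear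
in `K`, and the sum of `K` over the blocks is at most `2 d (a + 1) + N t`. As `v j` concentrates
near `1 / 4` for large `a`, nothing is lost in the limit.

Only finitely many `b` carry weight, so the averages over `b` and over the random seed can be
exchanged although nothing is assumed about how the output depends on `b`
(`finite_budget_inequality`). Letting `m`, then `N`, then `a` tend to infinity gives `d ≤ ε t`.
-/

/-! ### Adaptive programs and cylinder sets -/

namespace EntryAccessProgram

/-- If a quantity `D I x b` has nonnegative sum over every cylinder of vectors with prescribed
entries on `I`, whatever the fixed output `x`, then it has nonnegative sum along the runs of any
adaptive program: the vectors that lead to the same sequence of readings form such a cylinder. -/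
theorem sum_run_nonneg {n d : ℕ} (S : Finset (Fin n → ℕ))
    (D : Finset (Fin n) → EuclideanSpace ℝ (Fin d) → (Fin n → ℕ) → ℝ)
    (hD : ∀ I x, ∀ r ∈ S, 0 ≤ ∑ b ∈ S with ∀ i ∈ I, b i = r i, D I x b)
    (p : EntryAccessProgram n d) :
    0 ≤ ∑ b ∈ S, D (p.accessed (WithLp.toLp 2 fun i => (b i : ℝ)))
      (p.result (WithLp.toLp 2 fun i => (b i : ℝ))) b := by
  -- Generalize to runs that start with the entries on `I` already known.
  suffices h : ∀ I, ∀ r ∈ S, 0 ≤ ∑ b ∈ S with ∀ i ∈ I, b i = r i,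
      D (I ∪ p.accessed (WithLp.toLp 2 fun i => (b i : ℝ)))
        (p.result (WithLp.toLp 2 fun i => (b i : ℝ))) b by
    rcases S.eq_empty_or_nonempty with rfl | ⟨r, hr⟩
    · simp
    · simpa using h ∅ r hr
  induction p with
  | output x => intro I r hr; simpa [accessed, result] using hD I x r hr
  | access j next ih =>
    intro I r hr
    -- Split the cylinder according to the value that is read; each nonempty part is a cylinder.
    rw [← Finset.sum_fiberwise_of_maps_to (t := S.image fun b => b j) (g := fun b => b j)
      (fun b hb => Finset.mem_image_of_mem _ (Finset.mem_filter.1 hb).1)]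
    refine Finset.sum_nonneg fun v _ => ?_
    rw [Finset.filter_filter]
    rcases Finset.eq_empty_or_nonempty {b ∈ S | (∀ i ∈ I, b i = r i) ∧ b j = v} with h | ⟨r', hr'⟩
    · rw [h, Finset.sum_empty]
    · obtain ⟨hr'S, hr'I, rfl⟩ := Finset.mem_filter.1 hr'
      have hcyl : {b ∈ S | (∀ i ∈ I, b i = r i) ∧ b j = r' j}
          = {b ∈ S | ∀ i ∈ insert j I, b i = r' i} := by
        refine Finset.filter_congr fun b _ => ?_
        rw [Finset.forall_mem_insert, and_comm]
        exact and_congr_right fun _ => forall₂_congr fun i hi => by rw [hr'I i hi]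
      rw [hcyl]
      refine (ih (r' j) (insert j I) r' hr'S).trans_eq (Finset.sum_congr rfl fun b hb => ?_)
      have hbj : b j = r' j := (Finset.mem_filter.1 hb).2 j (Finset.mem_insert_self j I)
      simp only [accessed, result, hbj, Finset.insert_union, Finset.union_insert]

end EntryAccessProgram

/-! ### Beta integrals and integrals over the unit cube -/

/-- For a Beta(p + 1, q + 1) variable `x`, whose mean is `(p + 1) / (p + q + 2)`, this is the
relation `(p + q + 2) * Var x = E[x * (1 - x)]`, unnormalized and recentred at any `y`. -/
theorem integral_beta_quadratic (p q : ℕ) (y : ℝ) :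
    ∫ x in Set.Icc (0 : ℝ) 1, x ^ p * (1 - x) ^ q * ((p + q + 2) * (x - y) ^ 2 - x * (1 - x))
      = (p + q + 2) * (y - (p + 1) / (p + q + 2)) ^ 2 *
        ∫ x in Set.Icc (0 : ℝ) 1, x ^ p * (1 - x) ^ q := by
  have hK : (p + q + 2 : ℝ) ≠ 0 := by positivity
  rw [integral_Icc_eq_integral_Ioc, integral_Icc_eq_integral_Ioc,
    ← intervalIntegral.integral_of_le zero_le_one, ← intervalIntegral.integral_of_le zero_le_one,
    ← sub_eq_zero, ← intervalIntegral.integral_const_mul, ← intervalIntegral.integral_sub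
      (Continuous.intervalIntegrable (by fun_prop) _ _)
      (Continuous.intervalIntegrable (by fun_prop) _ _)]
  -- The difference of the two integrands is the derivative of a multiple of
  -- `x ^ (p + 1) * (1 - x) ^ (q + 1)`, which vanishes at both ends. The root of the linear factor
  -- is the reflection of the mean in `y`, so that the terms linear in `x` cancel.
  have hderiv : ∀ x : ℝ, HasDerivAt
      (fun x => -((x - (2 * y - (p + 1) / (p + q + 2))) * (x ^ (p + 1) * (1 - x) ^ (q + 1))))
      (x ^ p * (1 - x) ^ q * ((p + q + 2) * (x - y) ^ 2 - x * (1 - x))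
        - (p + q + 2) * (y - (p + 1) / (p + q + 2)) ^ 2 * (x ^ p * (1 - x) ^ q)) x := by
    intro x
    have h1 := ((hasDerivAt_id x).sub_const (2 * y - (p + 1 : ℝ) / (p + q + 2))).mul
      (((hasDerivAt_id x).pow (p + 1)).mul (((hasDerivAt_id x).const_sub 1).pow (q + 1)))
    refine h1.neg.congr_deriv ?_
    simp only [id_eq, Nat.add_sub_cancel, Nat.cast_add, Nat.cast_one, Pi.pow_apply, Pi.mul_apply]
    field_simp
    ring
  rw [intervalIntegral.integral_eq_sub_of_hasDerivAt (fun x _ => hderiv x)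
    (Continuous.intervalIntegrable (by fun_prop) _ _)]
  simp

theorem setIntegral_unitCube_prod {d : ℕ} (f : Fin d → ℝ → ℝ) :
    ∫ θ in Set.Icc (0 : Fin d → ℝ) 1, ∏ j, f j (θ j) = ∏ j, ∫ x in Set.Icc (0 : ℝ) 1, f j x := by
  rw [← Set.pi_univ_Icc, volume_pi, Measure.restrict_pi_pi]
  exact integral_fintype_prod_eq_prod f

theorem setIntegral_unitCube_prod_mul {d : ℕ} (f : Fin d → ℝ → ℝ) (g : ℝ → ℝ) (j : Fin d) :
    ∫ θ in Set.Icc (0 : Fin d → ℝ) 1, (∏ k, f k (θ k)) * g (θ j)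
      = (∏ k ∈ Finset.univ.erase j, ∫ x in Set.Icc (0 : ℝ) 1, f k x) *
        ∫ x in Set.Icc (0 : ℝ) 1, f j x * g x := by
  have h := setIntegral_unitCube_prod (Function.update f j fun x => f j x * g x)
  rw [← Finset.prod_erase_mul _ _ (Finset.mem_univ j)] at h
  simp only [Function.update_self] at h
  rw [Finset.prod_congr rfl fun k hk => by
    rw [Function.update_of_ne (Finset.ne_of_mem_erase hk)]] at h
  rw [← h]
  congr 1 with θ
  rw [← Finset.prod_erase_mul _ _ (Finset.mem_univ j),
    ← Finset.prod_erase_mul _ (fun k => Function.update f j _ k (θ k)) (Finset.mem_univ j),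
    Function.update_self, mul_assoc]
  congr 1
  exact Finset.prod_congr rfl fun k hk => by rw [Function.update_of_ne (Finset.ne_of_mem_erase hk)]

/-! ### Binomial weights -/

/-- The probability that a binomial variable with `N` trials of success probability `x` is `k`. -/
noncomputable def binomialWeight (N k : ℕ) (x : ℝ) : ℝ := N.choose k * x ^ k * (1 - x) ^ (N - k)

theorem binomialWeight_nonneg (N k : ℕ) {x : ℝ} (hx : x ∈ Set.Icc (0 : ℝ) 1) :
    0 ≤ binomialWeight N k x :=
  mul_nonneg (mul_nonneg (Nat.cast_nonneg _) (pow_nonneg hx.1 _))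
    (pow_nonneg (sub_nonneg.2 hx.2) _)

theorem eval_bernsteinPolynomial (N k : ℕ) (x : ℝ) :
    (bernsteinPolynomial ℝ N k).eval x = binomialWeight N k x := by
  simp [bernsteinPolynomial, binomialWeight]

theorem sum_binomialWeight (N : ℕ) (x : ℝ) :
    ∑ k ∈ Finset.range (N + 1), binomialWeight N k x = 1 := by
  have h := congr_arg (Polynomial.eval x) (bernsteinPolynomial.sum ℝ N)
  simpa [Polynomial.eval_finsetSum, eval_bernsteinPolynomial] using h

theorem sum_binomialWeight_mul (N : ℕ) (x : ℝ) :
    ∑ k ∈ Finset.range (N + 1), binomialWeight N k x * k = N * x := by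
  have h := congr_arg (Polynomial.eval x) (bernsteinPolynomial.sum_smul ℝ N)
  simpa [Polynomial.eval_finsetSum, eval_bernsteinPolynomial, mul_comm] using h

theorem sum_binomialWeight_mul_sub_sq (N : ℕ) (x y : ℝ) :
    ∑ k ∈ Finset.range (N + 1), binomialWeight N k x * (k - y) ^ 2
      = N * (x * (1 - x)) + (N * x - y) ^ 2 := by
  have h := congr_arg (Polynomial.eval x) (bernsteinPolynomial.variance ℝ N)
  simp only [Polynomial.eval_finsetSum, eval_bernsteinPolynomial, Polynomial.eval_mul,
    Polynomial.eval_pow, Polynomial.eval_sub, Polynomial.eval_X,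
    Polynomial.eval_natCast, nsmul_eq_mul, Polynomial.eval_one] at h
  have hsplit : ∀ k : ℕ, binomialWeight N k x * (k - y) ^ 2
      = (N * x - k) ^ 2 * binomialWeight N k x
        + 2 * (N * x - y) * (binomialWeight N k x * k)
        + (y ^ 2 - (N * x) ^ 2) * binomialWeight N k x := fun k => by ring
  simp only [hsplit, Finset.sum_add_distrib, ← Finset.mul_sum, h, sum_binomialWeight,
    sum_binomialWeight_mul]
  ring

/-! ### The beta-binomial prior -/

theorem sum_piFinset_cylinder_prod {n : ℕ} (T : Finset ℕ) (f : Fin n → ℕ → ℝ)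
    (I : Finset (Fin n)) {r : Fin n → ℕ} (hr : r ∈ Fintype.piFinset fun _ : Fin n => T) :
    ∑ b ∈ Fintype.piFinset (fun _ : Fin n => T) with ∀ i ∈ I, b i = r i, ∏ i, f i (b i)
      = ∏ i, if i ∈ I then f i (r i) else ∑ k ∈ T, f i k := by
  have hcyl : {b ∈ Fintype.piFinset (fun _ : Fin n => T) | ∀ i ∈ I, b i = r i}
      = Fintype.piFinset fun i => if i ∈ I then {r i} else T := by
    ext b
    simp only [Finset.mem_filter, Fintype.mem_piFinset] at hr ⊢
    constructor
    · rintro ⟨h1, h2⟩ i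
      by_cases hi : i ∈ I
      · simp [hi, h2 i hi]
      · simpa [hi] using h1 i
    · intro h
      refine ⟨fun i => ?_, fun i hi => by simpa [hi] using h i⟩
      by_cases hi : i ∈ I
      · have := h i
        simp only [hi, if_true, Finset.mem_singleton] at this
        exact this ▸ hr i
      · simpa [hi] using h i
  rw [hcyl, ← Finset.prod_univ_sum]
  refine Finset.prod_congr rfl fun i _ => ?_
  split_ifs <;> simp

/-- The probability of the vector `b` when its entries are independent and `b i` is binomial with
`N` trials and the success probability `θ (blk i)` of its block. -/
noncomputable def binomialLikelihood {n d : ℕ} (N : ℕ) (blk : Fin n → Fin d) (θ : Fin d → ℝ)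
    (b : Fin n → ℕ) : ℝ :=
  ∏ i, binomialWeight N (b i) (θ (blk i))

/-- The density at `θ` of `d` independent Beta(a + 1, a + 1) variables, without its normalizing
constant. -/
noncomputable def betaPrior {d : ℕ} (a : ℕ) (θ : Fin d → ℝ) : ℝ := ∏ j, θ j ^ a * (1 - θ j) ^ a

/-- The vectors of length `n` with entries in `{0, …, N}`. -/
def boundedVectors (n N : ℕ) : Finset (Fin n → ℕ) :=
  Fintype.piFinset fun _ => Finset.range (N + 1)

section Prior

variable {n d : ℕ} (N a : ℕ) (blk : Fin n → Fin d)

theorem betaPrior_nonneg {θ : Fin d → ℝ} (hθ : θ ∈ Set.Icc (0 : Fin d → ℝ) 1) :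
    0 ≤ betaPrior a θ :=
  Finset.prod_nonneg fun j _ => mul_nonneg (pow_nonneg (hθ.1 j) _)
    (pow_nonneg (sub_nonneg.2 (hθ.2 j)) _)

theorem binomialLikelihood_nonneg {θ : Fin d → ℝ} (hθ : θ ∈ Set.Icc (0 : Fin d → ℝ) 1)
    (b : Fin n → ℕ) : 0 ≤ binomialLikelihood N blk θ b :=
  Finset.prod_nonneg fun _ _ => binomialWeight_nonneg N _ ⟨hθ.1 _, hθ.2 _⟩

@[fun_prop]
theorem continuous_betaPrior : Continuous (betaPrior a : (Fin d → ℝ) → ℝ) := by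
  unfold betaPrior; fun_prop

@[fun_prop]
theorem continuous_binomialLikelihood (b : Fin n → ℕ) :
    Continuous fun θ : Fin d → ℝ => binomialLikelihood N blk θ b := by
  unfold binomialLikelihood binomialWeight; fun_prop

theorem sum_cylinder_binomialLikelihood (θ : Fin d → ℝ) (I : Finset (Fin n)) {r : Fin n → ℕ}
    (hr : r ∈ boundedVectors n N) :
    ∑ b ∈ boundedVectors n N with ∀ i ∈ I, b i = r i, binomialLikelihood N blk θ b
      = ∏ i ∈ I, binomialWeight N (r i) (θ (blk i)) := by
  unfold boundedVectors binomialLikelihood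
  rw [sum_piFinset_cylinder_prod _ (fun i k => binomialWeight N k (θ (blk i))) I hr]
  simp [sum_binomialWeight, Finset.prod_ite_mem]

theorem sum_cylinder_binomialLikelihood_mul_sub_sq (θ : Fin d → ℝ) (I : Finset (Fin n))
    {r : Fin n → ℕ} (hr : r ∈ boundedVectors n N) {l : Fin n} (hl : l ∉ I) (y : ℝ) :
    ∑ b ∈ boundedVectors n N with ∀ i ∈ I, b i = r i, binomialLikelihood N blk θ b * (b l - y) ^ 2
      = (∏ i ∈ I, binomialWeight N (r i) (θ (blk i))) *
        (N * (θ (blk l) * (1 - θ (blk l))) + (N * θ (blk l) - y) ^ 2) := by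
  unfold boundedVectors binomialLikelihood
  have hprod : ∀ b : Fin n → ℕ,
      (∏ i, binomialWeight N (b i) (θ (blk i))) * ((b l : ℝ) - y) ^ 2
        = ∏ i, binomialWeight N (b i) (θ (blk i)) * if i = l then ((b i : ℝ) - y) ^ 2 else 1 := by
    intro b
    rw [Finset.prod_mul_distrib]
    simp
  simp only [hprod]
  rw [sum_piFinset_cylinder_prod _
    (fun i k => binomialWeight N k (θ (blk i)) * if i = l then ((k : ℝ) - y) ^ 2 else 1) I hr]
  have hterm : ∀ i, (if i ∈ I then
        binomialWeight N (r i) (θ (blk i)) * (if i = l then ((r i : ℝ) - y) ^ 2 else 1)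
      else ∑ k ∈ Finset.range (N + 1),
        binomialWeight N k (θ (blk i)) * (if i = l then ((k : ℝ) - y) ^ 2 else 1))
      = (if i ∈ I then binomialWeight N (r i) (θ (blk i)) else 1) *
        if i = l then N * (θ (blk l) * (1 - θ (blk l))) + (N * θ (blk l) - y) ^ 2 else 1 := by
    intro i
    rcases eq_or_ne i l with rfl | hil
    · simp [hl, sum_binomialWeight_mul_sub_sq]
    · simp [hil, sum_binomialWeight]
  rw [Finset.prod_congr rfl fun i _ => hterm i, Finset.prod_mul_distrib]
  simp [Finset.prod_ite_mem]

theorem beta_mul_prod_binomialWeight {ι : Type*} (I : Finset ι) {r : ι → ℕ}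
    (x : ℝ) :
    x ^ a * (1 - x) ^ a * ∏ i ∈ I, binomialWeight N (r i) x
      = (∏ i ∈ I, (N.choose (r i) : ℝ)) *
        (x ^ (a + ∑ i ∈ I, r i) * (1 - x) ^ (a + ∑ i ∈ I, (N - r i))) := by
  simp only [binomialWeight, Finset.prod_mul_distrib, pow_add, Finset.prod_pow_eq_pow_sum]
  ring

/-- The sum of the two parameters of the (Beta) posterior distribution of `θ j` once the entries on
`I` are known: each known entry of block `j` contributes its `N` trials. -/
noncomputable def posteriorSize (I : Finset (Fin n)) (j : Fin d) : ℝ :=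
  2 * (a + 1) + N * {i ∈ I | blk i = j}.card

theorem posteriorSize_pos (I : Finset (Fin n)) (j : Fin d) : 0 < posteriorSize N a blk I j := by
  unfold posteriorSize; positivity

/-- With the entries on `I` known to be `r`, the posterior mean square error of any estimate `y` of
`N * θ j` is at least the posterior variance. -/
theorem posterior_quadratic_nonneg (hN : N ≠ 0) (I : Finset (Fin n)) {r : Fin n → ℕ}
    (hr : r ∈ boundedVectors n N) (j : Fin d) (y : ℝ) :
    0 ≤ ∫ θ in Set.Icc (0 : Fin d → ℝ) 1,
      betaPrior a θ * (∏ i ∈ I, binomialWeight N (r i) (θ (blk i))) *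
        ((N * θ j - y) ^ 2 - N ^ 2 * (θ j * (1 - θ j)) / posteriorSize N a blk I j) := by
  have hfactor : ∀ θ : Fin d → ℝ,
      betaPrior a θ * (∏ i ∈ I, binomialWeight N (r i) (θ (blk i)))
        = ∏ k, (θ k ^ a * (1 - θ k) ^ a *
            ∏ i ∈ I with blk i = k, binomialWeight N (r i) (θ k)) := by
    intro θ
    rw [Finset.prod_mul_distrib, betaPrior, ← Finset.prod_fiberwise I blk]
    congr 1
    refine Finset.prod_congr rfl fun k _ => Finset.prod_congr rfl fun i hi => ?_
    rw [(Finset.mem_filter.1 hi).2]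
  simp only [hfactor]
  rw [setIntegral_unitCube_prod_mul
    (fun k x => x ^ a * (1 - x) ^ a * ∏ i ∈ I with blk i = k, binomialWeight N (r i) x)
    (fun x => (N * x - y) ^ 2 - N ^ 2 * (x * (1 - x)) / posteriorSize N a blk I j) j]
  refine mul_nonneg (Finset.prod_nonneg fun k _ => setIntegral_nonneg measurableSet_Icc
    fun x hx => mul_nonneg (mul_nonneg (pow_nonneg hx.1 _) (pow_nonneg (sub_nonneg.2 hx.2) _))
      (Finset.prod_nonneg fun i _ => binomialWeight_nonneg N _ hx)) ?_
  simp only [beta_mul_prod_binomialWeight]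
  set p := a + ∑ i ∈ I with blk i = j, r i
  set q := a + ∑ i ∈ I with blk i = j, (N - r i)
  have hpq : (p + q + 2 : ℝ) = posteriorSize N a blk I j := by
    have h : p + q + 2 = 2 * (a + 1) + N * {i ∈ I | blk i = j}.card := by
      have : ∑ i ∈ I with blk i = j, r i + ∑ i ∈ I with blk i = j, (N - r i)
          = N * {i ∈ I | blk i = j}.card := by
        rw [← Finset.sum_add_distrib, Finset.sum_congr rfl (g := fun _ => N), Finset.sum_const,
          smul_eq_mul, mul_comm]
        intro i _
        have := Finset.mem_range.1 (Fintype.mem_piFinset.1 hr i)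
        omega
      omega
    unfold posteriorSize
    exact_mod_cast h
  have hK := posteriorSize_pos N a blk I j
  have hN' : (N : ℝ) ≠ 0 := Nat.cast_ne_zero.2 hN
  have hintegrand : ∀ x : ℝ, (∏ i ∈ I with blk i = j, (N.choose (r i) : ℝ)) *
      (x ^ p * (1 - x) ^ q) *
        ((N * x - y) ^ 2 - N ^ 2 * (x * (1 - x)) / posteriorSize N a blk I j)
      = (∏ i ∈ I with blk i = j, (N.choose (r i) : ℝ)) * (N ^ 2 / posteriorSize N a blk I j) *
        (x ^ p * (1 - x) ^ q * ((p + q + 2) * (x - y / N) ^ 2 - x * (1 - x))) := by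
    intro x
    rw [hpq]
    field_simp
  simp only [hintegrand]
  rw [integral_const_mul, integral_beta_quadratic, hpq]
  have : 0 ≤ ∫ x in Set.Icc (0 : ℝ) 1, x ^ p * (1 - x) ^ q :=
    setIntegral_nonneg measurableSet_Icc fun x hx =>
      mul_nonneg (pow_nonneg hx.1 _) (pow_nonneg (sub_nonneg.2 hx.2) _)
  positivity

/-- With the entries on `I` known to be `r`, the mean square error of predicting another entry `b l`
by `y` is at least the binomial variance plus the posterior variance of `N * θ (blk l)`. -/
theorem unread_entry_risk_nonneg (hN : N ≠ 0) (I : Finset (Fin n)) {r : Fin n → ℕ}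
    (hr : r ∈ boundedVectors n N) {l : Fin n} (hl : l ∉ I) (y : ℝ) :
    0 ≤ ∑ b ∈ boundedVectors n N with ∀ i ∈ I, b i = r i,
      ∫ θ in Set.Icc (0 : Fin d → ℝ) 1, betaPrior a θ * binomialLikelihood N blk θ b *
        ((b l - y) ^ 2 - (N + N ^ 2 / posteriorSize N a blk I (blk l)) *
          (θ (blk l) * (1 - θ (blk l)))) := by
  rw [← integral_finsetSum _ fun b _ => Continuous.integrableOn_Icc (by fun_prop)]
  refine (posterior_quadratic_nonneg N a blk hN I hr (blk l) y).trans_eq ?_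
  congr 1 with θ
  simp only [mul_assoc, ← Finset.mul_sum, mul_sub, Finset.sum_sub_distrib]
  simp only [← Finset.sum_mul, sum_cylinder_binomialLikelihood N blk θ I hr,
    sum_cylinder_binomialLikelihood_mul_sub_sq N blk θ I hr hl]
  ring

end Prior

/-! ### Bayes risk for the block design -/

section BayesRisk

variable {n d : ℕ} (N a : ℕ) (blk : Fin n → Fin d)

/-- The matrix whose `i`-th row is the standard basis vector of index `blk i`. -/
def blockMatrix : Matrix (Fin n) (Fin d) ℝ := Matrix.of fun i j => if blk i = j then 1 else 0

theorem norm_lsResidual_blockMatrix_sq (b : EuclideanSpace ℝ (Fin n))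
    (x : EuclideanSpace ℝ (Fin d)) :
    ‖lsResidual (blockMatrix blk) b x‖ ^ 2 = ∑ i, (b i - x (blk i)) ^ 2 := by
  rw [EuclideanSpace.real_norm_sq_eq]
  refine Finset.sum_congr rfl fun i _ => ?_
  simp [lsResidual, blockMatrix, Matrix.toLpLin_apply, Matrix.mulVec, dotProduct]

/-- The marginal weight of the vector `b`, as unnormalized as `betaPrior`. -/
noncomputable def priorWeight (b : Fin n → ℕ) : ℝ :=
  ∫ θ in Set.Icc (0 : Fin d → ℝ) 1, betaPrior a θ * binomialLikelihood N blk θ b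

theorem priorWeight_nonneg (b : Fin n → ℕ) : 0 ≤ priorWeight N a blk b :=
  setIntegral_nonneg measurableSet_Icc fun _ hθ =>
    mul_nonneg (betaPrior_nonneg a hθ) (binomialLikelihood_nonneg N blk hθ b)

theorem mul_one_sub_nonneg_of_mem_unitCube {θ : Fin d → ℝ} (hθ : θ ∈ Set.Icc (0 : Fin d → ℝ) 1)
    (j : Fin d) : 0 ≤ θ j * (1 - θ j) :=
  mul_nonneg (hθ.1 j) (sub_nonneg.2 (hθ.2 j))

/-- A lower bound for `N² v / K` that is linear in `v` and in `K` separately, hence insensitive to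
correlations between them; it is tight for `v = 1 / 4` and `K = N / ε`. -/
theorem tangent_line_le_div {v K N ε : ℝ} (hv : 0 ≤ v) (hv' : v ≤ 1 / 4) (hK : 0 < K) :
    2 * ε * N * v - ε ^ 2 / 4 * K ≤ N ^ 2 / K * v := by
  have h : N ^ 2 / K * v - 2 * ε * N * v + ε ^ 2 * K * v = v * (N - ε * K) ^ 2 / K := by
    field_simp
    ring
  have h' : 0 ≤ v * (N - ε * K) ^ 2 / K := by positivity
  nlinarith [mul_nonneg (mul_nonneg (sq_nonneg ε) hK.le) (sub_nonneg.2 hv')]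

theorem sum_posteriorSize (I : Finset (Fin n)) :
    ∑ j, posteriorSize N a blk I j = d * (2 * (a + 1)) + N * I.card := by
  simp only [posteriorSize, Finset.sum_add_distrib, ← Finset.mul_sum, Finset.sum_const,
    Finset.card_univ, Fintype.card_fin, nsmul_eq_mul]
  rw [Finset.card_eq_sum_card_fiberwise (f := blk) (t := Finset.univ) (s := I)
    (fun _ _ => Finset.mem_coe.2 (Finset.mem_univ _))]
  push_cast
  ring

/-- A function of `θ` alone that bounds from below, for every set of at most `t` known entries and
blocks of `m` rows, the sum over the unread entries of the conjugacy bound of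
`unread_entry_risk_nonneg`. -/
noncomputable def riskBound (m t : ℕ) (ε : ℝ) (θ : Fin d → ℝ) : ℝ :=
  (m - t) * ((1 + 2 * ε) * N * ∑ j, θ j * (1 - θ j)
    - ε ^ 2 / 4 * (d * (2 * (a + 1)) + N * t))

@[fun_prop]
theorem continuous_riskBound (m t : ℕ) (ε : ℝ) :
    Continuous (riskBound N a m t ε : (Fin d → ℝ) → ℝ) := by
  unfold riskBound; fun_prop

theorem riskBound_le_sum_unread {m t : ℕ}
    (hm : ∀ j, ({i | blk i = j} : Finset (Fin n)).card = m) (htm : t ≤ m) (ε : ℝ) {θ : Fin d → ℝ} (hθ : θ ∈ Set.Icc (0 : Fin d → ℝ) 1) {I : Finset (Fin n)}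
    (hI : I.card ≤ t) :
    riskBound N a m t ε θ ≤ ∑ i ∈ Iᶜ, (N + N ^ 2 / posteriorSize N a blk I (blk i)) *
      (θ (blk i) * (1 - θ (blk i))) := by
  rw [← Finset.sum_fiberwise (Iᶜ) blk]
  set g : Fin d → ℝ := fun j => (N + N ^ 2 / posteriorSize N a blk I j) * (θ j * (1 - θ j))
    with hg
  have hfiber : ∀ j, ∑ i ∈ Iᶜ with blk i = j, g (blk i)
      = ({i ∈ Iᶜ | blk i = j}.card : ℝ) * g j := by
    intro j
    rw [Finset.sum_congr rfl (g := fun _ => g j) fun i hi => by rw [(Finset.mem_filter.1 hi).2],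
      Finset.sum_const, nsmul_eq_mul]
  have hcard : ∀ j, (m - t : ℝ) ≤ ({i ∈ Iᶜ | blk i = j}.card : ℝ) := by
    intro j
    have h1 := hm j
    have h2 : ({i | blk i = j} : Finset (Fin n)) ⊆ {i ∈ Iᶜ | blk i = j} ∪ I := by
      intro i hi
      by_cases h : i ∈ I <;> simp_all
    have h3 := (Finset.card_le_card h2).trans (Finset.card_union_le _ _)
    have h4 : m ≤ {i ∈ Iᶜ | blk i = j}.card + t := by omega
    rw [sub_le_iff_le_add]
    exact_mod_cast h4
  have hmt : (0 : ℝ) ≤ m - t := sub_nonneg.2 (Nat.cast_le.2 htm)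
  have hg0 : ∀ j, 0 ≤ g j := fun j =>
    mul_nonneg (add_nonneg (Nat.cast_nonneg _)
      (div_nonneg (sq_nonneg _) (posteriorSize_pos N a blk I j).le))
      (mul_one_sub_nonneg_of_mem_unitCube hθ j)
  have hg1 : ∀ j, (1 + 2 * ε) * N * (θ j * (1 - θ j)) - ε ^ 2 / 4 * posteriorSize N a blk I j
      ≤ g j := by
    intro j
    have := tangent_line_le_div (N := N) (ε := ε) (mul_one_sub_nonneg_of_mem_unitCube hθ j)
      (by nlinarith [sq_nonneg (θ j - 1 / 2)]) (posteriorSize_pos N a blk I j)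
    simp only [hg]
    linarith
  have hcardI : (N * I.card : ℝ) ≤ N * t := by gcongr
  calc riskBound N a m t ε θ
      ≤ (m - t) * ((1 + 2 * ε) * N * ∑ j, θ j * (1 - θ j)
          - ε ^ 2 / 4 * ∑ j, posteriorSize N a blk I j) := by
        rw [sum_posteriorSize, riskBound]
        gcongr
    _ = (m - t) * ∑ j, ((1 + 2 * ε) * N * (θ j * (1 - θ j))
          - ε ^ 2 / 4 * posteriorSize N a blk I j) := by
        rw [Finset.sum_sub_distrib, Finset.mul_sum, Finset.mul_sum]
    _ ≤ (m - t) * ∑ j, g j := by gcongr with j; exact hg1 j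
    _ ≤ ∑ j, ∑ i ∈ Iᶜ with blk i = j, g (blk i) := by
        rw [Finset.mul_sum]
        refine Finset.sum_le_sum fun j _ => ?_
        rw [hfiber]
        exact mul_le_mul_of_nonneg_right (hcard j) (hg0 j)

theorem sum_binomialLikelihood (θ : Fin d → ℝ) :
    ∑ b ∈ boundedVectors n N, binomialLikelihood N blk θ b = 1 := by
  have h := sum_cylinder_binomialLikelihood N blk θ ∅ (r := 0)
    (Fintype.mem_piFinset.2 fun _ => by simp)
  simpa using h

/-- A lower bound for the Bayes risk of a deterministic program reading at most `t` entries. -/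
theorem integral_riskBound_le_program_risk (hN : N ≠ 0) {m t : ℕ}
    (hm : ∀ j, ({i | blk i = j} : Finset (Fin n)).card = m) (htm : t ≤ m) (ε : ℝ)
    (p : EntryAccessProgram n d)
    (hp : ∀ b ∈ boundedVectors n N, (p.accessed (WithLp.toLp 2 fun i => (b i : ℝ))).card ≤ t) :
    ∫ θ in Set.Icc (0 : Fin d → ℝ) 1, betaPrior a θ * riskBound N a m t ε θ
      ≤ ∑ b ∈ boundedVectors n N, priorWeight N a blk b *
        ‖lsResidual (blockMatrix blk) (WithLp.toLp 2 fun i => (b i : ℝ))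
          (p.result (WithLp.toLp 2 fun i => (b i : ℝ)))‖ ^ 2 := by
  have hrun := p.sum_run_nonneg (boundedVectors n N) (fun I x b => ∑ i ∈ Iᶜ,
    ∫ θ in Set.Icc (0 : Fin d → ℝ) 1, betaPrior a θ * binomialLikelihood N blk θ b *
        ((b i - x (blk i)) ^ 2 - (N + N ^ 2 / posteriorSize N a blk I (blk i)) *
          (θ (blk i) * (1 - θ (blk i))))) (by
    intro I x r hr
    rw [Finset.sum_comm]
    exact Finset.sum_nonneg fun i hi =>
      unread_entry_risk_nonneg N a blk hN I hr (Finset.mem_compl.1 hi) _)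
  have hmass : ∫ θ in Set.Icc (0 : Fin d → ℝ) 1, betaPrior a θ * riskBound N a m t ε θ
      = ∑ b ∈ boundedVectors n N, ∫ θ in Set.Icc (0 : Fin d → ℝ) 1,
        betaPrior a θ * binomialLikelihood N blk θ b * riskBound N a m t ε θ := by
    rw [← integral_finsetSum _ fun b _ => Continuous.integrableOn_Icc (by fun_prop)]
    congr 1 with θ
    rw [← Finset.sum_mul, ← Finset.mul_sum, sum_binomialLikelihood, mul_one]
  -- Discarding the squared errors at the entries that were read only decreases the loss.
  rw [hmass, ← sub_nonneg, ← Finset.sum_sub_distrib]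
  refine hrun.trans (Finset.sum_le_sum fun b hb => ?_)
  rw [← integral_finsetSum _ fun i _ => Continuous.integrableOn_Icc (by fun_prop), priorWeight,
    ← integral_mul_const, ← integral_sub (Continuous.integrableOn_Icc (by fun_prop))
      (Continuous.integrableOn_Icc (by fun_prop))]
  refine setIntegral_mono_on (Continuous.integrableOn_Icc (by fun_prop))
    (Continuous.integrableOn_Icc (by fun_prop)) measurableSet_Icc fun θ hθ => ?_
  rw [← Finset.mul_sum, ← mul_sub, Finset.sum_sub_distrib]
  refine mul_le_mul_of_nonneg_left (sub_le_sub ?_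
      (riskBound_le_sum_unread N a blk hm htm ε hθ (hp b hb)))
    (mul_nonneg (betaPrior_nonneg a hθ) (binomialLikelihood_nonneg N blk hθ b))
  rw [norm_lsResidual_blockMatrix_sq]
  exact Finset.sum_le_univ_sum_of_nonneg fun i => sq_nonneg _

/-- The mean optimal residual error is at most the mean residual error at `x j = N * θ j`. -/
theorem sum_priorWeight_mul_optimum_le {m : ℕ}
    (hm : ∀ j, ({i | blk i = j} : Finset (Fin n)).card = m)
    (opt : (Fin n → ℕ) → ℝ) (hopt : ∀ b x, opt b ≤
      ‖lsResidual (blockMatrix blk) (WithLp.toLp 2 fun i => (b i : ℝ)) x‖ ^ 2) :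
    ∑ b ∈ boundedVectors n N, priorWeight N a blk b * opt b
      ≤ ∫ θ in Set.Icc (0 : Fin d → ℝ) 1, betaPrior a θ * (m * N * ∑ j, θ j * (1 - θ j)) := by
  simp only [priorWeight, ← integral_mul_const]
  rw [← integral_finsetSum _ fun b _ => Continuous.integrableOn_Icc (by fun_prop)]
  refine setIntegral_mono_on (Continuous.integrableOn_Icc (by fun_prop))
    (Continuous.integrableOn_Icc (by fun_prop)) measurableSet_Icc fun θ hθ => ?_
  simp only [mul_assoc]
  rw [← Finset.mul_sum]
  refine mul_le_mul_of_nonneg_left ?_ (betaPrior_nonneg a hθ)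
  calc ∑ b ∈ boundedVectors n N, binomialLikelihood N blk θ b * opt b
      ≤ ∑ b ∈ boundedVectors n N, ∑ i,
          binomialLikelihood N blk θ b * (b i - N * θ (blk i)) ^ 2 := by
        refine Finset.sum_le_sum fun b _ => ?_
        rw [← Finset.mul_sum]
        refine mul_le_mul_of_nonneg_left ((hopt b (WithLp.toLp 2 fun j => N * θ j)).trans_eq ?_)
          (binomialLikelihood_nonneg N blk hθ b)
        rw [norm_lsResidual_blockMatrix_sq]
    _ = ∑ i, N * (θ (blk i) * (1 - θ (blk i))) := by
        rw [Finset.sum_comm]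
        refine Finset.sum_congr rfl fun i _ => ?_
        have h := sum_cylinder_binomialLikelihood_mul_sub_sq N blk θ ∅ (r := 0)
          (Fintype.mem_piFinset.2 fun _ => by simp) (Finset.notMem_empty i) (N * θ (blk i))
        simpa using h
    _ = m * (N * ∑ j, θ j * (1 - θ j)) := by
        rw [← Finset.sum_fiberwise Finset.univ blk, Finset.mul_sum, Finset.mul_sum]
        refine Finset.sum_congr rfl fun j _ => ?_
        rw [Finset.sum_congr rfl (g := fun _ => N * (θ j * (1 - θ j)))
          fun i hi => by rw [(Finset.mem_filter.1 hi).2], Finset.sum_const, nsmul_eq_mul, hm j]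

end BayesRisk

/-! ### Normalization of the prior -/

theorem integral_symmetric_beta_pos (a : ℕ) :
    0 < ∫ x in Set.Icc (0 : ℝ) 1, x ^ a * (1 - x) ^ a := by
  rw [integral_Icc_eq_integral_Ioc, ← intervalIntegral.integral_of_le zero_le_one]
  exact intervalIntegral.intervalIntegral_pos_of_pos_on
    (Continuous.intervalIntegrable (by fun_prop) _ _)
    (fun x hx => mul_pos (pow_pos hx.1 _) (pow_pos (sub_pos.2 hx.2) _)) zero_lt_one

theorem integral_symmetric_beta_mul_one_sub (a : ℕ) :
    ∫ x in Set.Icc (0 : ℝ) 1, x ^ a * (1 - x) ^ a * (x * (1 - x))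
      = (a + 1) / (2 * (2 * a + 3)) * ∫ x in Set.Icc (0 : ℝ) 1, x ^ a * (1 - x) ^ a := by
  have h := integral_beta_quadratic a a (1 / 2)
  have hmean : (1 / 2 : ℝ) - (a + 1) / (a + a + 2) = 0 := by
    field_simp
    ring
  have hsplit : ∀ x : ℝ, x ^ a * (1 - x) ^ a * ((a + a + 2) * (x - 1 / 2) ^ 2 - x * (1 - x))
      = (a + 1) / 2 * (x ^ a * (1 - x) ^ a)
        - (2 * a + 3) * (x ^ a * (1 - x) ^ a * (x * (1 - x))) := fun x => by ring
  simp only [hsplit, hmean] at h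
  rw [integral_sub (Continuous.integrableOn_Icc (by fun_prop))
    (Continuous.integrableOn_Icc (by fun_prop)), integral_const_mul, integral_const_mul] at h
  have h3 : (2 * a + 3 : ℝ) ≠ 0 := by positivity
  refine mul_left_cancel₀ h3 ((sub_eq_zero.1 (h.trans (by ring))).symm.trans ?_)
  field_simp

theorem integral_betaPrior_pos (d a : ℕ) :
    0 < ∫ θ in Set.Icc (0 : Fin d → ℝ) 1, betaPrior a θ := by
  unfold betaPrior
  rw [setIntegral_unitCube_prod fun _ x => x ^ a * (1 - x) ^ a]
  exact Finset.prod_pos fun _ _ => integral_symmetric_beta_pos a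

theorem integral_betaPrior_mul_sum (d a : ℕ) :
    ∫ θ in Set.Icc (0 : Fin d → ℝ) 1, betaPrior a θ * ∑ j, θ j * (1 - θ j)
      = d * ((a + 1) / (2 * (2 * a + 3))) * ∫ θ in Set.Icc (0 : Fin d → ℝ) 1, betaPrior a θ := by
  simp only [Finset.mul_sum]
  rw [integral_finsetSum _ fun b _ => Continuous.integrableOn_Icc (by fun_prop)]
  have h : ∀ j : Fin d, ∫ θ in Set.Icc (0 : Fin d → ℝ) 1, betaPrior a θ * (θ j * (1 - θ j))
      = (a + 1) / (2 * (2 * a + 3)) * ∫ θ in Set.Icc (0 : Fin d → ℝ) 1, betaPrior a θ := by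
    intro j
    unfold betaPrior
    rw [setIntegral_unitCube_prod_mul (fun _ x => x ^ a * (1 - x) ^ a) (fun x => x * (1 - x)) j,
      integral_symmetric_beta_mul_one_sub, setIntegral_unitCube_prod fun _ x => x ^ a * (1 - x) ^ a,
      ← Finset.prod_erase_mul _ _ (Finset.mem_univ j)]
    ring
  simp only [h, Finset.sum_const, Finset.card_univ, Fintype.card_fin, nsmul_eq_mul]
  ring

/-! ### Comparison of the risks -/

/-- The comparison of the Bayes risk with `(1 + ε)` times the mean optimum, after division by the
mass of the prior; `(a + 1) / (2 * (2 * a + 3))` is the prior mean of `θ j * (1 - θ j)`. -/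
theorem finite_budget_inequality {ε : ℝ} (hε : 0 < ε) {d : ℕ} (hd : 1 ≤ d)
    {Ω : Type*} [MeasurableSpace Ω] (P : Measure Ω) [IsProbabilityMeasure P]
    (alg : LeastSquaresAlgorithm d Ω) (t : ℕ)
    (ht : AccessesAtMost P alg t) (halg : HasMeanSquareResidualError P alg ε)
    {m N : ℕ} (a : ℕ) (hN : N ≠ 0) (hm : 2 ≤ m) (htm : t ≤ m) :
    (m - t) * ((1 + 2 * ε) * N * (d * ((a + 1) / (2 * (2 * a + 3))))
        - ε ^ 2 / 4 * (d * (2 * (a + 1)) + N * t))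
      ≤ (1 + ε) * (m * N * (d * ((a + 1) / (2 * (2 * a + 3))))) := by
  let blk : Fin (d * m) → Fin d := fun i => (finProdFinEquiv.symm i).1
  have hblk : ∀ j, ({i | blk i = j} : Finset (Fin (d * m))).card = m := by
    intro j
    have hfiber : ({i | blk i = j} : Finset (Fin (d * m)))
        = Finset.univ.image fun k : Fin m => finProdFinEquiv (j, k) := by
      ext i
      obtain ⟨⟨j', k⟩, rfl⟩ := finProdFinEquiv.surjective i
      simp only [blk, Finset.mem_filter_univ, Equiv.symm_apply_apply, Finset.mem_image,
        Finset.mem_univ, true_and, EmbeddingLike.apply_eq_iff_eq, Prod.mk.injEq]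
      exact ⟨fun h => ⟨k, h.symm, rfl⟩, fun ⟨_, h, _⟩ => h.symm⟩
    rw [hfiber, Finset.card_image_of_injective _ fun k l h => by simpa using h,
      Finset.card_univ, Fintype.card_fin]
  have hdn : d < d * m := by nlinarith
  let vec : (Fin (d * m) → ℕ) → EuclideanSpace ℝ (Fin (d * m)) :=
    fun b => WithLp.toLp 2 fun i => (b i : ℝ)
  choose xstar hxstar using exists_isLeastSquaresSolution (blockMatrix blk)
  have hloss := fun b => halg (d * m) (blockMatrix blk) (vec b) (xstar (vec b)) hdn (hxstar (vec b))
  have hread : ∀ᵐ ω ∂P, ∀ b ∈ boundedVectors (d * m) N,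
      ((alg (d * m) (blockMatrix blk) ω).accessed (vec b)).card ≤ t :=
    (Finset.eventually_all _).2 fun b _ => ht (d * m) (blockMatrix blk) (vec b) hdn
  have hlower : ∫ θ in Set.Icc (0 : Fin d → ℝ) 1, betaPrior a θ * riskBound N a m t ε θ
      ≤ ∫ ω, ∑ b ∈ boundedVectors (d * m) N, priorWeight N a blk b *
        ‖lsResidual (blockMatrix blk) (vec b)
          ((alg (d * m) (blockMatrix blk) ω).result (vec b))‖ ^ 2 ∂P := by
    have hconst : ∀ c : ℝ, c = ∫ _, c ∂P := fun c => by simp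
    refine (hconst _).trans_le (integral_mono_ae (integrable_const _)
      (integrable_finsetSum _ fun b _ => (hloss b).1.const_mul _) ?_)
    filter_upwards [hread] with ω hω
    exact integral_riskBound_le_program_risk N a blk hN hblk htm ε _ hω
  have hupper : ∫ ω, ∑ b ∈ boundedVectors (d * m) N, priorWeight N a blk b *
        ‖lsResidual (blockMatrix blk) (vec b)
          ((alg (d * m) (blockMatrix blk) ω).result (vec b))‖ ^ 2 ∂P
      ≤ (1 + ε) * ∑ b ∈ boundedVectors (d * m) N, priorWeight N a blk b *
        ‖lsResidual (blockMatrix blk) (vec b) (xstar (vec b))‖ ^ 2 := by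
    rw [integral_finsetSum _ fun b _ => (hloss b).1.const_mul _, Finset.mul_sum]
    refine Finset.sum_le_sum fun b _ => ?_
    rw [integral_const_mul, mul_left_comm]
    exact mul_le_mul_of_nonneg_left (hloss b).2 (priorWeight_nonneg N a blk b)
  have hoptimum := sum_priorWeight_mul_optimum_le N a blk hblk
    (fun b => ‖lsResidual (blockMatrix blk) (vec b) (xstar (vec b))‖ ^ 2)
    fun b x => hxstar (vec b) x
  have hZ := integral_betaPrior_pos d a
  have hV := integral_betaPrior_mul_sum d a
  have hleft : ∫ θ in Set.Icc (0 : Fin d → ℝ) 1, betaPrior a θ * riskBound N a m t ε θ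
      = (m - t) * ((1 + 2 * ε) * N * (d * ((a + 1) / (2 * (2 * a + 3))))
        - ε ^ 2 / 4 * (d * (2 * (a + 1)) + N * t)) *
        ∫ θ in Set.Icc (0 : Fin d → ℝ) 1, betaPrior a θ := by
    have hsplit : ∀ θ : Fin d → ℝ, betaPrior a θ * riskBound N a m t ε θ
        = (m - t) * ((1 + 2 * ε) * N) * (betaPrior a θ * ∑ j, θ j * (1 - θ j))
          - (m - t) * (ε ^ 2 / 4 * (d * (2 * (a + 1)) + N * t)) * betaPrior a θ := fun θ => by
      rw [riskBound]; ring
    simp only [hsplit]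
    rw [integral_sub (Continuous.integrableOn_Icc (by fun_prop))
      (Continuous.integrableOn_Icc (by fun_prop)), integral_const_mul, integral_const_mul, hV]
    ring
  simp only [mul_left_comm (betaPrior a _)] at hoptimum
  rw [integral_const_mul, hV] at hoptimum
  rw [hleft] at hlower
  refine le_of_mul_le_mul_right (hlower.trans (hupper.trans ?_)) hZ
  refine (mul_le_mul_of_nonneg_left hoptimum (by positivity)).trans_eq ?_
  ring

open Filter Topology in
theorem mainTheorem7 (ε : ℝ) (hε : 0 < ε) (d : ℕ) (hd : 1 ≤ d)
    {Ω : Type*} [MeasurableSpace Ω] (P : Measure Ω) [IsProbabilityMeasure P]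
    (alg : LeastSquaresAlgorithm d Ω) (t : ℕ)
    (ht : AccessesAtMost P alg t) (halg : HasMeanSquareResidualError P alg ε) :
    (d : ℝ) / ε ≤ (t : ℝ) := by
  have hdivNat : ∀ c : ℝ, Tendsto (fun k : ℕ => c / (k : ℝ)) atTop (𝓝 0) :=
    fun c => tendsto_const_div_atTop_nhds_zero_nat c
  have hv : Tendsto (fun a : ℕ => ((a : ℝ) + 1) / (2 * (2 * a + 3))) atTop (𝓝 (1 / 4)) := by
    have h : Tendsto (fun a : ℕ => (1 + 1 / (a : ℝ)) / (4 + 6 / (a : ℝ))) atTop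
        (𝓝 ((1 + 0) / (4 + 0))) :=
      ((hdivNat 1).const_add 1).div ((hdivNat 6).const_add 4) (by norm_num)
    rw [show (1 + 0 : ℝ) / (4 + 0) = 1 / 4 by norm_num] at h
    refine h.congr' ?_
    filter_upwards [eventually_ge_atTop 1] with a ha
    have : (a : ℝ) ≠ 0 := by positivity
    field_simp
    ring
  -- The limit of large blocks, `m → ∞`.
  have hlimm : ∀ a N : ℕ, N ≠ 0 →
      (1 + 2 * ε) * N * (d * ((a + 1) / (2 * (2 * a + 3))))
        - ε ^ 2 / 4 * (d * (2 * (a + 1)) + N * t)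
      ≤ (1 + ε) * N * (d * ((a + 1) / (2 * (2 * a + 3)))) := by
    intro a N hN
    have h := ((hdivNat t).const_sub 1).mul_const
      ((1 + 2 * ε) * N * (d * ((a + 1) / (2 * (2 * a + 3))))
        - ε ^ 2 / 4 * (d * (2 * (a + 1)) + N * t))
    rw [sub_zero, one_mul] at h
    refine le_of_tendsto h ?_
    filter_upwards [eventually_ge_atTop 2, eventually_ge_atTop t] with m hm htm
    have hm0 : (0 : ℝ) < m := by positivity
    refine le_of_mul_le_mul_left ?_ hm0
    have := finite_budget_inequality hε hd P alg t ht halg a hN hm htm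
    rw [← mul_assoc, mul_sub (m : ℝ) 1, mul_one, mul_div_cancel₀ _ hm0.ne']
    linarith
  -- The limit of precise entries, `N → ∞`.
  have hlimN : ∀ a : ℕ, ε * (d * ((a + 1) / (2 * (2 * a + 3)))) ≤ ε ^ 2 / 4 * t := by
    intro a
    have h := ((hdivNat (d * (2 * (a + 1)))).add_const (t : ℝ)).const_mul (ε ^ 2 / 4)
    rw [zero_add] at h
    refine ge_of_tendsto h ?_
    filter_upwards [eventually_ne_atTop 0] with N hN
    have hN0 : (0 : ℝ) < N := by positivity
    refine le_of_mul_le_mul_left ?_ hN0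
    have h1 := hlimm a N hN
    have h2 : N * (ε ^ 2 / 4 * (d * (2 * (a + 1)) / N + t))
        = ε ^ 2 / 4 * (d * (2 * (a + 1)) + N * t) := by
      field_simp
    rw [h2]
    linarith
  -- The limit `a → ∞` of a prior concentrated at `1 / 2`.
  have hlima := le_of_tendsto' ((hv.const_mul (d : ℝ)).const_mul ε) hlimN
  rw [div_le_iff₀ hε]
  nlinarith
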